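/- Let $d\ge 1$ and let $M=H^0(\mathcal O_{\mathbf P^1}(d))^{\oplus 5}\simeq\mathbb C^{5d+5}$ be the space of 5-tuples of binary forms of degree $d$. For $c\in M$ and $t\in\mathbb C\subset\mathbf P^1$ write $c(t)\in\mathbb C^5$ for the value of $c$ at $t$. Let $f_0,f_1,f_2$ be quintic forms in $z_0,\dots,z_4$ (spanning a plane of quintic threefolds with open subset $\mathbb L$), and let $\mathbf t=(t_1,\dots,t_{5d+1})$ be complex numbers. For $i=3,\dots,5d+1$ let $\phi_i$ be the differential 1-form on $M$ $$\phi_i=\mathbf d\begin{vmatrix} f_2(c(t_i)) & f_1(c(t_i)) & f_0(c(t_i))\\ f_2(c(t_1)) & f_1(c(t_1)) & f_0(c(t_1))\\ f_2(c(t_2)) & f_1(c(t_2)) & f_0(c(t_2))\end{vmatrix},\qquad \omega(\mathbb L,\mathbf t)=\phi_3\wedge\cdots\wedge\phi_{5d+1}.$$ Let $c_g\in M$ be any point (in particular, a generic point of an irreducible component of the incidence scheme of curves lying on some quintic of $\mathbb L$), put $$\delta_2=\begin{vmatrix} f_1(c_g(t_1)) & f_0(c_g(t_1))\\ f_1(c_g(t_2))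 & f_0(c_g(t_2))\end{vmatrix},\quad \delta_1=\begin{vmatrix} f_0(c_g(t_1)) & f_2(c_g(t_1))\\ f_0(c_g(t_2)) & f_2(c_g(t_2))\end{vmatrix},\quad \delta_0=\begin{vmatrix} f_2(c_g(t_1)) & f_1(c_g(t_1))\\ f_2(c_g(t_2)) & f_1(c_g(t_2))\end{vmatrix},$$ and let $f_3=\delta_2f_2+\delta_1f_1+\delta_0f_0$ (with these constant coefficients). Let $C_M$ be any system of holomorphic coordinates on a neighbourhood of $c_g$ in $M$, and let $\mathcal A$ be the $(5d+5)\times(5d+5)$ Jacobian matrix $$\mathcal A=\left.\frac{\partial\bigl(f_3(c(t_3)),\dots,f_3(c(t_{5d+1})),\,f_0(c(t_1)),f_1(c(t_1)),f_2(c(t_1)),f_0(c(t_2)),f_1(c(t_2)),f_2(c(t_2))\bigr)}{\partial C_M}\right|_{c_g}.$$ Then the rows of $\mathcal A$ represent, in the coordinates $C_M$, the $5d+5$ differential 1-forms $\mathbf d f_3(c(t_k))|_{c_g}$ ($k=3,\dots,5d+1$) and $\mathbf d f_l(c(t_j))|_{c_g}$ ($l=0,1,2$, $j=1,2$) in $T^*_{c_g}M$,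 and if $\mathcal A$ is non-degenerate, then the form $\omega(\mathbb L,\mathbf t)$ does not vanish at $c_g$. -/

import Mathlib

noncomputable section

namespace QuinticCurves

/-- The vector space `H⁰(𝒪_{P⁴}(5))` of quintic forms in `z₀, …, z₄`. -/
abbrev Quintic : Type := MvPolynomial.homogeneousSubmodule (Fin 5) ℂ 5

/-- The space `M = H⁰(𝒪_{P¹}(d))^{⊕5} ≅ ℂ^{5d+5}` of 5-tuples of binary forms of degree `d`.
The `i`-th form is recorded by its coefficients: `c i j` is the coefficient of `t ^ j` in the
restriction of the form to the affine line `ℂ ⊂ P¹`. -/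
abbrev M (d : ℕ) : Type := Fin 5 → Fin (d + 1) → ℂ

/-- The cotangent space of `M` at any of its points. -/
abbrev Cotangent (d : ℕ) : Type := M d →L[ℂ] ℂ

/-- The point `c(t) ∈ ℂ⁵`. -/
def curve {d : ℕ} (c : M d) (t : ℂ) : Fin 5 → ℂ := fun i => ∑ j : Fin (d + 1), c i j * t ^ (j : ℕ)

/-- The number `g(c(t))`. -/
def pull {d : ℕ} (g : Quintic) (t : ℂ) (c : M d) : ℂ := MvPolynomial.eval (curve c t) g.1

/-- The points are numbered `t₁, …, t_{5d+1}` in the mathematics and `t 0, …, t (5d)` in the code.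
This is the pair `(t₁, t₂)`, for `d ≥ 1`. -/
def basePoint {d : ℕ} (t : Fin (5 * d + 1) → ℂ) : Fin 2 → ℂ := ![t 0, t 1]

/-- The remaining points: `i : Fin (5d-1)` gives `t_{i+3}`. -/
def otherPoint {d : ℕ} (t : Fin (5 * d + 1) → ℂ) (i : Fin (5 * d - 1)) : ℂ :=
  t ⟨i + 2, by omega⟩

/-- The `3 × 3` determinant, as a function of `c ∈ M`, that defines the projected incidence scheme;
`s` is one of the points `t₃, …, t_{5d+1}`. -/
def incidenceDet {d : ℕ} (f : Fin 3 → Quintic) (t : Fin (5 * d + 1) → ℂ) (s : ℂ) (c : M d) : ℂ :=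
  Matrix.det
    !![pull (f 2) s c, pull (f 1) s c, pull (f 0) s c;
       pull (f 2) (basePoint t 0) c, pull (f 1) (basePoint t 0) c, pull (f 0) (basePoint t 0) c;
       pull (f 2) (basePoint t 1) c, pull (f 1) (basePoint t 1) c, pull (f 0) (basePoint t 1) c]

/-- The 1-form `φ_{i+3}` on `M`: the differential of the determinant for the point `t_{i+3}`. -/
def phi {d : ℕ} (f : Fin 3 → Quintic) (t : Fin (5 * d + 1) → ℂ) (i : Fin (5 * d - 1)) (c : M d) :
    Cotangent d :=
  fderiv ℂ (incidenceDet f t (otherPoint t i)) c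

/-- The value at `c` of the `(5d-1)`-form `ω(𝕃, 𝐭) = φ₃ ∧ ⋯ ∧ φ_{5d+1}`,
an element of the exterior power `⋀^{5d-1}` of the cotangent space at `c`. -/
def omegaForm {d : ℕ} (f : Fin 3 → Quintic) (t : Fin (5 * d + 1) → ℂ) (c : M d) :
    ⋀[ℂ]^(5 * d - 1) (Cotangent d) :=
  exteriorPower.ιMulti ℂ (5 * d - 1) fun i => phi f t i c

/-- The minor `| g(c(t₁)) h(c(t₁)) ; g(c(t₂)) h(c(t₂)) |`. -/
def minor {d : ℕ} (g h : Quintic) (t : Fin (5 * d + 1) → ℂ) (c : M d) : ℂ :=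
  Matrix.det
    !![pull g (basePoint t 0) c, pull h (basePoint t 0) c;
       pull g (basePoint t 1) c, pull h (basePoint t 1) c]

/-- The quintic `f₃ = δ₂ f₂ + δ₁ f₁ + δ₀ f₀`, whose coefficients are the minors at the fixed
point `cg`. -/
def f3 {d : ℕ} (f : Fin 3 → Quintic) (t : Fin (5 * d + 1) → ℂ) (cg : M d) : Quintic :=
  minor (f 1) (f 0) t cg • f 2 + minor (f 0) (f 2) t cg • f 1 + minor (f 2) (f 1) t cg • f 0

/-- The `5d+5` functions on `M` whose differentials are the rows of `𝒜`: first
`f₃(c(t₃)), …, f₃(c(t_{5d+1}))`, then `f₀(c(t₁)), f₁(c(t₁)), f₂(c(t₁)), f₀(c(t₂)), f₁(c(t₂)),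
f₂(c(t₂))`. -/
def rowFunction {d : ℕ} (f : Fin 3 → Quintic) (t : Fin (5 * d + 1) → ℂ) (cg : M d) :
    Fin (5 * d - 1) ⊕ Fin 2 × Fin 3 → M d → ℂ
  | Sum.inl k => pull (f3 f t cg) (otherPoint t k)
  | Sum.inr (j, l) => pull (f l) (basePoint t j)

/-- The order of the rows of `𝒜`. -/
def rowIndex {d : ℕ} (hd : 1 ≤ d) : Fin (5 * d - 1) ⊕ Fin 2 × Fin 3 ≃ Fin (5 * d + 5) :=
  ((Equiv.sumCongr (Equiv.refl _) finProdFinEquiv).trans finSumFinEquiv).trans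
    (finCongr (by omega))

/-- A local system of holomorphic coordinates `C_M` on `M`: a biholomorphic map from an open subset
of `M` onto an open subset of `ℂ^{5d+5}`. -/
def IsHolomorphicChart {d : ℕ} (C : OpenPartialHomeomorph (M d) (Fin (5 * d + 5) → ℂ)) : Prop :=
  DifferentiableOn ℂ C C.source ∧ DifferentiableOn ℂ C.symm C.target

/-- The partial derivative at `p` of a function `g` on `M` with respect to the `s`-th coordinate of
the chart `C`. -/
def partialDeriv {d : ℕ} (C : OpenPartialHomeomorph (M d) (Fin (5 * d + 5) → ℂ))
    (g : M d → ℂ) (p : M d) (s : Fin (5 * d + 5)) : ℂ :=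
  fderiv ℂ (fun x => g (C.symm x)) (C p) (Pi.single s 1)

/-- The square Jacobian matrix `𝒜(C_M, f₀, f₁, f₂, 𝐭)` at `cg`. -/
def matrixA {d : ℕ} (hd : 1 ≤ d) (C : OpenPartialHomeomorph (M d) (Fin (5 * d + 5) → ℂ))
    (f : Fin 3 → Quintic) (t : Fin (5 * d + 1) → ℂ) (cg : M d) :
    Matrix (Fin (5 * d + 5)) (Fin (5 * d + 5)) ℂ :=
  Matrix.of fun r s => partialDeriv C (rowFunction f t cg ((rowIndex hd).symm r)) cg s

end QuinticCurves

end

/-!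
Write `δ₂, δ₁, δ₀` for the minors of the rows at `t₁, t₂`. Expanding the incidence determinant along
its first row gives `∑ δ_l(c) f_l(c(s))`, so by the product rule its differential at `cg` is
`∑ δ_l(cg) d f_l(c(s)) + ∑ f_l(cg(s)) d δ_l`. The first sum is `d f₃(c(s))`, and each `d δ_l` is a
combination of the six forms `d f_m(c(t_j))`, `j = 1, 2` (`phi_sub_fderiv_mem_span`). Hence `φ_k`
agrees with the row `d f₃(c(t_k))` modulo the span of the last six rows of `𝒜`.

The entries of a row of `𝒜` are the values of the corresponding form on the coordinate vector
fields, by the chain rule. So `det 𝒜 ≠ 0` makes the `5d+5` forms linearly independent; modulo the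
last six, the remaining ones stay independent, and therefore so do the `φ_k`
(`LinearIndependent.of_sub_mem_span`). A wedge product of linearly independent forms over a field
is nonzero.
-/

section LinearAlgebra

/-- In a linearly independent family indexed by a sum type, the first part may be changed by
elements of the span of the second part without losing its independence. -/
theorem LinearIndependent.of_sub_mem_span {R V ι κ : Type*} [Ring R] [AddCommGroup V] [Module R V]
    {v : ι ⊕ κ → V} (hv : LinearIndependent R v) {w : ι → V}
    (hw : ∀ i, w i - v (Sum.inl i) ∈ Submodule.span R (Set.range (v ∘ Sum.inr))) :
    LinearIndependent R w := by
  obtain ⟨hl, -, hdisj⟩ := linearIndependent_sum.1 hv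
  set N := Submodule.span R (Set.range (v ∘ Sum.inr)) with hN
  have hq : LinearIndependent R (N.mkQ ∘ v ∘ Sum.inl) :=
    hl.map (by rwa [Submodule.ker_mkQ])
  have heq : N.mkQ ∘ w = N.mkQ ∘ v ∘ Sum.inl := by
    funext i
    exact (Submodule.Quotient.eq N).2 (hw i)
  exact LinearIndependent.of_comp N.mkQ (heq ▸ hq)

theorem exteriorPower.ιMulti_ne_zero_of_linearIndependent {K E : Type*} [Field K] [AddCommGroup E]
    [Module K E] {n : ℕ} {v : Fin n → E} (hv : LinearIndependent K v) :
    exteriorPower.ιMulti K n v ≠ 0 := by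
  -- The wedge of `v` is the member of `ιMulti_family v` indexed by all of `Fin n`.
  have hne := (exteriorPower.ιMulti_family_linearIndependent_field n hv).ne_zero
    (Set.powersetCard.ofFinEmbEquiv (RelEmbedding.refl _ : Fin n ↪o Fin n))
  simpa [exteriorPower.ιMulti_family] using hne

end LinearAlgebra

namespace QuinticCurves

variable {d : ℕ}

theorem differentiable_pull (g : Quintic) (s : ℂ) : Differentiable ℂ (pull (d := d) g s) := by
  unfold pull curve
  simp_rw [MvPolynomial.eval_eq]
  fun_prop

theorem incidenceDet_eq (f : Fin 3 → Quintic) (t : Fin (5 * d + 1) → ℂ) (s : ℂ) :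
    (incidenceDet f t s : M d → ℂ) = minor (f 1) (f 0) t * pull (f 2) s +
      minor (f 0) (f 2) t * pull (f 1) s + minor (f 2) (f 1) t * pull (f 0) s := by
  funext c
  simp [incidenceDet, minor, Matrix.det_fin_three, Matrix.det_fin_two]
  ring

theorem pull_f3 (f : Fin 3 → Quintic) (t : Fin (5 * d + 1) → ℂ) (cg : M d) (s : ℂ) :
    (pull (f3 f t cg) s : M d → ℂ) = minor (f 1) (f 0) t cg • pull (f 2) s +
      minor (f 0) (f 2) t cg • pull (f 1) s + minor (f 2) (f 1) t cg • pull (f 0) s := by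
  funext c
  simp [pull, f3, MvPolynomial.smul_eval]

theorem minor_eq (g h : Quintic) (t : Fin (5 * d + 1) → ℂ) :
    (minor g h t : M d → ℂ) = pull g (basePoint t 0) * pull h (basePoint t 1) -
      pull h (basePoint t 0) * pull g (basePoint t 1) := by
  funext c
  simp [minor, Matrix.det_fin_two]

theorem differentiable_minor (g h : Quintic) (t : Fin (5 * d + 1) → ℂ) :
    Differentiable ℂ (minor g h t : M d → ℂ) := by
  rw [minor_eq]
  exact ((differentiable_pull _ _).mul (differentiable_pull _ _)).sub
    ((differentiable_pull _ _).mul (differentiable_pull _ _))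

theorem differentiable_rowFunction (f : Fin 3 → Quintic) (t : Fin (5 * d + 1) → ℂ) (cg : M d)
    (r : Fin (5 * d - 1) ⊕ Fin 2 × Fin 3) : Differentiable ℂ (rowFunction f t cg r) := by
  rcases r with k | ⟨j, l⟩ <;> exact differentiable_pull _ _

theorem fderiv_minor_mem_span (f : Fin 3 → Quintic) (t : Fin (5 * d + 1) → ℂ) (cg : M d)
    (l m : Fin 3) :
    fderiv ℂ (minor (f l) (f m) t) cg ∈ Submodule.span ℂ
      (Set.range ((fun r => fderiv ℂ (rowFunction f t cg r) cg) ∘ Sum.inr)) := by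
  have hmem : ∀ j l, fderiv ℂ (pull (f l) (basePoint t j)) cg ∈ Submodule.span ℂ
      (Set.range ((fun r => fderiv ℂ (rowFunction f t cg r) cg) ∘ Sum.inr)) :=
    fun j l => Submodule.subset_span ⟨(j, l), rfl⟩
  have hd := fun (j : Fin 2) (l : Fin 3) =>
    (differentiable_pull (f l) (basePoint t j) cg).hasFDerivAt
  rw [minor_eq, (((hd 0 l).mul (hd 1 m)).sub ((hd 0 m).mul (hd 1 l))).fderiv]
  exact sub_mem (add_mem (Submodule.smul_mem _ _ (hmem _ _)) (Submodule.smul_mem _ _ (hmem _ _)))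
    (add_mem (Submodule.smul_mem _ _ (hmem _ _)) (Submodule.smul_mem _ _ (hmem _ _)))

/-- Modulo the forms `d f_l(c(t₁))` and `d f_l(c(t₂))`, the form `φ_k` at `cg` is
`d f₃(c(t_k))`. -/
theorem phi_sub_fderiv_mem_span (f : Fin 3 → Quintic) (t : Fin (5 * d + 1) → ℂ) (cg : M d)
    (k : Fin (5 * d - 1)) :
    phi f t k cg - fderiv ℂ (rowFunction f t cg (Sum.inl k)) cg ∈ Submodule.span ℂ
      (Set.range ((fun r => fderiv ℂ (rowFunction f t cg r) cg) ∘ Sum.inr)) := by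
  have hp := fun l : Fin 3 => (differentiable_pull (f l) (otherPoint t k) cg).hasFDerivAt
  have hm := fun l m : Fin 3 => (differentiable_minor (f l) (f m) t cg).hasFDerivAt
  have hs := fun (l m : Fin 3) (a : ℂ) =>
    Submodule.smul_mem _ a (fderiv_minor_mem_span f t cg l m)
  have hphi := ((((hm 1 0).mul (hp 2)).add ((hm 0 2).mul (hp 1))).add ((hm 2 1).mul (hp 0))).fderiv
  have hrow := ((((hp 2).const_smul (minor (f 1) (f 0) t cg)).add
    ((hp 1).const_smul (minor (f 0) (f 2) t cg))).add
    ((hp 0).const_smul (minor (f 2) (f 1) t cg))).fderiv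
  convert add_mem (add_mem (hs 1 0 (pull (f 2) (otherPoint t k) cg))
    (hs 0 2 (pull (f 1) (otherPoint t k) cg))) (hs 2 1 (pull (f 0) (otherPoint t k) cg)) using 1
  rw [phi, incidenceDet_eq, rowFunction, pull_f3, hphi, hrow]
  abel

/-- Chain rule: the partial derivatives of `g` are the values of its differential on the images of
the coordinate vectors. -/
theorem partialDeriv_eq {C : OpenPartialHomeomorph (M d) (Fin (5 * d + 5) → ℂ)}
    (hC : IsHolomorphicChart C) {p : M d} (hp : p ∈ C.source) {g : M d → ℂ}
    (hg : Differentiable ℂ g) (s : Fin (5 * d + 5)) :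
    partialDeriv C g p s = fderiv ℂ g p (fderiv ℂ C.symm (C p) (Pi.single s 1)) := by
  have hsymm := (hC.2.differentiableAt (C.open_target.mem_nhds (C.map_source hp))).hasFDerivAt
  have hg' : HasFDerivAt g (fderiv ℂ g p) (C.symm (C p)) := by
    rw [C.left_inv hp]
    exact (hg p).hasFDerivAt
  rw [partialDeriv, show (fun x => g (C.symm x)) = g ∘ C.symm from rfl,
    (hg'.comp _ hsymm).fderiv]
  rfl

theorem fderiv_symm_fderiv_apply {C : OpenPartialHomeomorph (M d) (Fin (5 * d + 5) → ℂ)}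
    (hC : IsHolomorphicChart C) {p : M d} (hp : p ∈ C.source) (v : M d) :
    fderiv ℂ C.symm (C p) (fderiv ℂ C p v) = v := by
  have hsymm := (hC.2.differentiableAt (C.open_target.mem_nhds (C.map_source hp))).hasFDerivAt
  have hCp := (hC.1.differentiableAt (C.open_source.mem_nhds hp)).hasFDerivAt
  have hid : HasFDerivAt (C.symm ∘ C) (ContinuousLinearMap.id ℂ (M d)) p :=
    (hasFDerivAt_id p).congr_of_eventuallyEq (C.eventually_left_inverse hp)
  exact DFunLike.congr_fun ((hsymm.comp p hCp).unique hid) v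

/-- The expansion `dg = ∑ (∂g/∂x_s) dx_s` in a holomorphic chart. -/
theorem fderiv_eq_sum_partialDeriv {C : OpenPartialHomeomorph (M d) (Fin (5 * d + 5) → ℂ)}
    (hC : IsHolomorphicChart C) {p : M d} (hp : p ∈ C.source) {g : M d → ℂ}
    (hg : Differentiable ℂ g) :
    fderiv ℂ g p = ∑ s, partialDeriv C g p s • fderiv ℂ (fun c => C c s) p := by
  have hCp := hC.1.differentiableAt (C.open_source.mem_nhds hp)
  ext v
  have hs : ∀ s, fderiv ℂ (fun c => C c s) p v = fderiv ℂ C p v s := fun s => by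
    rw [(hasFDerivAt_pi'.1 hCp.hasFDerivAt s).fderiv]
    rfl
  conv_lhs => rw [← fderiv_symm_fderiv_apply hC hp v, pi_eq_sum_univ' (fderiv ℂ C p v)]
  simp only [map_sum, map_smul, sum_apply, smul_apply,
    partialDeriv_eq hC hp hg, hs, smul_eq_mul]
  exact Finset.sum_congr rfl fun s _ => mul_comm _ _

/-- If `𝒜` is non-degenerate, the forms represented by its rows are linearly independent. -/
theorem linearIndependent_fderiv_rowFunction (hd : 1 ≤ d) (f : Fin 3 → Quintic)
    (t : Fin (5 * d + 1) → ℂ) {cg : M d} {C : OpenPartialHomeomorph (M d) (Fin (5 * d + 5) → ℂ)}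
    (hC : IsHolomorphicChart C) (hcg : cg ∈ C.source) (hA : (matrixA hd C f t cg).det ≠ 0) :
    LinearIndependent ℂ (fun r => fderiv ℂ (rowFunction f t cg r) cg) := by
  have hrows : LinearIndependent ℂ (matrixA hd C f t cg).row :=
    Matrix.linearIndependent_rows_of_det_ne_zero hA
  -- Evaluation on the coordinate vectors sends each form to its row of `𝒜`.
  let ev : Cotangent d →ₗ[ℂ] Fin (5 * d + 5) → ℂ := LinearMap.pi fun s =>
    (ContinuousLinearMap.apply ℂ ℂ (fderiv ℂ C.symm (C cg) (Pi.single s 1))).toLinearMap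
  have hev : (ev ∘ fun r => fderiv ℂ (rowFunction f t cg r) cg) =
      (matrixA hd C f t cg).row ∘ rowIndex hd := by
    funext r s
    simp [ev, matrixA, Matrix.row_def,
      partialDeriv_eq hC hcg (differentiable_rowFunction f t cg _)]
  exact LinearIndependent.of_comp ev (hev ▸ hrows.comp _ (rowIndex hd).injective)

end QuinticCurves

open QuinticCurves in
theorem proposition1p6 (d : ℕ) (hd : 1 ≤ d) (f : Fin 3 → Quintic) (t : Fin (5 * d + 1) → ℂ)
    (cg : M d) (C : OpenPartialHomeomorph (M d) (Fin (5 * d + 5) → ℂ))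
    (hC : IsHolomorphicChart C) (hcg : cg ∈ C.source) :
    (∀ r, fderiv ℂ (rowFunction f t cg r) cg =
        ∑ s, matrixA hd C f t cg (rowIndex hd r) s • fderiv ℂ (fun c => C c s) cg) ∧
      ((matrixA hd C f t cg).det ≠ 0 → omegaForm f t cg ≠ 0) := by
  refine ⟨fun r => ?_, fun hA => ?_⟩
  · simpa only [matrixA, Matrix.of_apply, Equiv.symm_apply_apply] using
      fderiv_eq_sum_partialDeriv hC hcg (differentiable_rowFunction f t cg r)
  · exact exteriorPower.ιMulti_ne_zero_of_linearIndependent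
      ((linearIndependent_fderiv_rowFunction hd f t hC hcg hA).of_sub_mem_span
        fun k => phi_sub_fderiv_mem_span f t cg k)
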